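/- Let $m\ge 1$ and $n\ge 0$ be integers, $\lambda\ge 0$ and $p\in[1,\infty)$. Let $\mathbb B^m=\{x\in\mathbb R^m:|x|\le 1\}$ be the closed Euclidean unit ball and $x_0=(1,0,\ldots,0)\in\mathbb R^m$. Let $\mathcal P_{n,m}$ be the space of polynomials in $m$ real variables with complex coefficients and total degree at most $n$, and let $\mathcal P_n$ be the space of polynomials in one real variable with complex coefficients and degree at most $n$. For a closed set $\Omega\subset\mathbb R^d$, a weight $W:\Omega\to[0,\infty]$, a point $y\in\Omega$ and a linear space $B$ of functions put $$\|h\|_{L_{p,W}(\Omega)}=\Bigl(\int_\Omega|h(x)|^pW(x)\,dx\Bigr)^{1/p},\qquad \mathcal N_{y}\bigl(B,L_{p,W}(\Omega)\bigr)=\sup_{h\in B\setminus\{0\}}\frac{|h(y)|}{\|h\|_{L_{p,W}(\Omega)}}.$$ Then $$\mathcal N_{x_0}\Bigl(\mathcal P_{n,m},L_{p,(1-|x|^2)^{\lambda-1/2}}(\mathbb B^m)\Bigr)=C_{19}\,\mathcal N_{1}\Bigl(\mathcal P_{n},L_{p,(1-u^2)^{m/2+\lambda-1}}([-1,1])\Bigr),\qquad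 C_{19}=\left(\frac{\Gamma(\lambda+m/2)}{\pi^{(m-1)/2}\,\Gamma(\lambda+1/2)}\right)^{1/p}.$$ -/

import Mathlib

open scoped ENNReal

noncomputable section

/-- The weighted quasinorm `(∫_Ω |F(x)|^r W(x) dx)^{1/r}`, `0 < r < ∞`, with a weight `W` taking
values in `[0, ∞]`. The value is `∞` exactly when the integral diverges. -/
def weightedNorm {X : Type*} [MeasureTheory.MeasureSpace X] (r : ℝ) (W : X → ℝ≥0∞) (Ω : Set X)
    (F : X → ℂ) : ℝ≥0∞ :=
  (∫⁻ x in Ω, ‖F x‖ₑ ^ r * W x) ^ (1 / r)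

/-- The sharp constant of point evaluation at `x₀`: the supremum of `|h(x₀)| / ‖h‖`, with the
weighted quasinorm over `Ω`, over all nonzero `h` in the space `B`. -/
def pointConstant {X : Type*} [MeasureTheory.MeasureSpace X] (x₀ : X) (B : Submodule ℂ (X → ℂ)) (r : ℝ)
    (W : X → ℝ≥0∞) (Ω : Set X) : ℝ≥0∞ :=
  ⨆ h ∈ {h : X → ℂ | h ∈ B ∧ h ≠ 0}, ‖h x₀‖ₑ / weightedNorm r W Ω h

/-- Polynomial functions on `ℝ^m` with complex coefficients and total degree at most `n`. -/
def polyFun (n m : ℕ) : Submodule ℂ (EuclideanSpace ℝ (Fin m) → ℂ) where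
  carrier := {f | ∃ P : MvPolynomial (Fin m) ℂ, P.totalDegree ≤ n ∧
    ∀ x, f x = MvPolynomial.eval (fun i => (x i : ℂ)) P}
  zero_mem' := ⟨0, by simp, by simp⟩
  add_mem' := by
    rintro f g ⟨P, hP, hf⟩ ⟨Q, hQ, hg⟩
    exact ⟨P + Q, (MvPolynomial.totalDegree_add P Q).trans (max_le hP hQ),
      fun x => by simp [hf x, hg x]⟩
  smul_mem' := by
    rintro c f ⟨P, hP, hf⟩
    exact ⟨c • P, (MvPolynomial.totalDegree_smul_le c P).trans hP,
      fun x => by simp [hf x]⟩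

/-- Polynomial functions on `ℝ` with complex coefficients and degree at most `n`. -/
def polyFunOne (n : ℕ) : Submodule ℂ (ℝ → ℂ) where
  carrier := {f | ∃ P : Polynomial ℂ, P.natDegree ≤ n ∧ ∀ u, f u = P.eval (u : ℂ)}
  zero_mem' := ⟨0, by simp, by simp⟩
  add_mem' := by
    rintro f g ⟨P, hP, hf⟩ ⟨Q, hQ, hg⟩
    exact ⟨P + Q, (Polynomial.natDegree_add_le P Q).trans (max_le hP hQ),
      fun x => by simp [hf x, hg x]⟩
  smul_mem' := by
    rintro c f ⟨P, hP, hf⟩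
    exact ⟨c • P, (Polynomial.natDegree_smul_le c P).trans hP,
      fun x => by simp [hf x]⟩

/-- The constant `(Γ(lam + m/2) / (π^{(m-1)/2} Γ(lam + 1/2)))^{1/p}`. -/
def reductionConstant (m : ℕ) (p lam : ℝ) : ℝ :=
  (Real.Gamma (lam + (m : ℝ) / 2) /
    (Real.pi ^ (((m : ℝ) - 1) / 2) * Real.Gamma (lam + 1 / 2))) ^ (1 / p)

end

open MeasureTheory Metric Set

/-! Write `m = k + 1`, `a = lam - 1/2`, and parametrise the ball by `x = (u, √(1 - u²) y)` with `u ∈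
[-1, 1]` and `y` in the `k`-dimensional unit ball. The weighted measure becomes a product, `(1 -
u²)^(a + k/2) du` times `(1 - |y|²)^a dy` (`lintegral_jacobiMeasure_eq_lintegral_fiber`); let `K` be
the mass of the second factor. The constant of the theorem is `K^(-1/p)`.

For `≥`, a univariate `q` lifts to `x ↦ q (x 0)`, which keeps the value at the evaluation point and
multiplies the norm by `K^(1/p)`. For `≤`, integrate `h` over the fibers in `y`. The result is a
polynomial in `u` of degree at most `n`, because odd moments vanish
(`exists_polynomial_eval_eq_integral_fiber`). The fiber over `u = 1` is a single point, so its value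
there is `K h(x₀)`, while Hölder on each fiber (`enorm_integral_rpow_le`) bounds its norm by `K^(1 -
1/p) ‖h‖`. -/

/-! ### Slicing the weighted ball along the first coordinate -/

theorem lintegral_eq_ofReal_pow_mul_lintegral_smul {E : Type*} [NormedAddCommGroup E]
    [NormedSpace ℝ E] [FiniteDimensional ℝ E] [MeasurableSpace E] [BorelSpace E] (μ : Measure E)
    [μ.IsAddHaarMeasure] {F : E → ℝ≥0∞} (hF : Measurable F) {c : ℝ} (hc : 0 < c) :
    ∫⁻ x, F x ∂μ = ENNReal.ofReal (c ^ Module.finrank ℝ E) * ∫⁻ x, F (c • x) ∂μ := by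
  have hpos : 0 < c ^ Module.finrank ℝ E := by positivity
  rw [← lintegral_map hF (measurable_const_smul c), Measure.map_addHaar_smul μ hc.ne',
    lintegral_smul_measure, smul_eq_mul, ← mul_assoc, ← ENNReal.ofReal_mul hpos.le,
    abs_of_pos (inv_pos.2 hpos), mul_inv_cancel₀ hpos.ne', ENNReal.ofReal_one, one_mul]

/-- The vector of `ℝ^{k+1}` with first coordinate `u` and remaining coordinates `y`. -/
def consVec {k : ℕ} (u : ℝ) (y : EuclideanSpace ℝ (Fin k)) : EuclideanSpace ℝ (Fin (k + 1)) :=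
  WithLp.toLp 2 (Fin.cons u y.ofLp)

@[simp] theorem consVec_zero_apply {k : ℕ} (u : ℝ) (y : EuclideanSpace ℝ (Fin k)) :
    consVec u y 0 = u := rfl

@[simp] theorem consVec_succ_apply {k : ℕ} (u : ℝ) (y : EuclideanSpace ℝ (Fin k)) (i : Fin k) :
    consVec u y i.succ = y i := rfl

theorem norm_consVec_sq {k : ℕ} (u : ℝ) (y : EuclideanSpace ℝ (Fin k)) :
    ‖consVec u y‖ ^ 2 = u ^ 2 + ‖y‖ ^ 2 := by
  simp [EuclideanSpace.norm_sq_eq, Fin.sum_univ_succ]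

theorem measurable_consVec {k : ℕ} :
    Measurable fun q : ℝ × EuclideanSpace ℝ (Fin k) => consVec q.1 q.2 := by
  refine (WithLp.measurable_toLp 2 _).comp (measurable_pi_iff.2 fun i => ?_)
  refine Fin.cases ?_ (fun j => ?_) i
  · exact measurable_fst
  · exact (measurable_pi_apply j).comp ((WithLp.measurable_ofLp 2 _).comp measurable_snd)

theorem lintegral_eq_lintegral_consVec {k : ℕ} {F : EuclideanSpace ℝ (Fin (k + 1)) → ℝ≥0∞}
    (hF : Measurable F) : ∫⁻ x, F x = ∫⁻ u : ℝ, ∫⁻ y, F (consVec u y) := by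
  have hmeas := hF.comp (measurable_consVec (k := k))
  have hto := PiLp.volume_preserving_toLp (Fin (k + 1))
  have hsplit := (volume_preserving_piFinSuccAbove (fun _ : Fin (k + 1) => ℝ) 0).symm
  have hof := (MeasurePreserving.id (volume : Measure ℝ)).prod
    (PiLp.volume_preserving_ofLp (Fin k))
  have h := ((hto.comp hsplit).comp hof).lintegral_comp hF
  rw [← h]
  have hcons (q : ℝ × EuclideanSpace ℝ (Fin k)) : (WithLp.toLp 2 ∘
      (MeasurableEquiv.piFinSuccAbove (fun _ : Fin (k + 1) => ℝ) 0).symm)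
        (Prod.map id WithLp.ofLp q) =
        consVec q.1 q.2 := by
    simp [consVec, MeasurableEquiv.piFinSuccAbove, Fin.insertNthEquiv]
  simp only [Function.comp_apply] at hcons ⊢
  simp only [hcons]
  exact lintegral_prod (μ := (volume : Measure ℝ))
    (ν := (volume : Measure (EuclideanSpace ℝ (Fin k)))) _ hmeas.aemeasurable

/-- The measure `(1 - |x|²)^a dx` on the closed unit ball. -/
noncomputable def jacobiMeasure (E : Type*) [NormedAddCommGroup E] [MeasureSpace E] (a : ℝ) :
    Measure E :=
  (volume.restrict (closedBall 0 1)).withDensity fun x => ENNReal.ofReal (1 - ‖x‖ ^ 2) ^ a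

section

variable {E : Type*} [NormedAddCommGroup E] [MeasureSpace E] [BorelSpace E]

theorem measurable_jacobiWeight (a : ℝ) :
    Measurable fun x : E => ENNReal.ofReal (1 - ‖x‖ ^ 2) ^ a := by
  fun_prop

theorem lintegral_jacobiMeasure (a : ℝ) {F : E → ℝ≥0∞} (hF : Measurable F) :
    ∫⁻ x, F x ∂jacobiMeasure E a =
      ∫⁻ x in closedBall 0 1, ENNReal.ofReal (1 - ‖x‖ ^ 2) ^ a * F x :=
  lintegral_withDensity_eq_lintegral_mul _ (measurable_jacobiWeight a) hF

end

instance {E : Type*} [NormedAddCommGroup E] [MeasureSpace E] [BorelSpace E]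
    [SFinite (volume : Measure E)] (a : ℝ) : SFinite (jacobiMeasure E a) := by
  unfold jacobiMeasure; infer_instance

/-- Rescaling each slice to the unit ball factors the weight, since `1 - |x|² = (1 - u²)(1 - |y|²)`;
the Jacobian `√(1 - u²)^k` accounts for the shift of the exponent by `k/2`. -/
theorem lintegral_jacobiMeasure_eq_lintegral_fiber {k : ℕ} (a : ℝ)
    {F : EuclideanSpace ℝ (Fin (k + 1)) → ℝ≥0∞} (hF : Measurable F) :
    ∫⁻ x, F x ∂jacobiMeasure (EuclideanSpace ℝ (Fin (k + 1))) a =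
      ∫⁻ u : ℝ, ∫⁻ y, F (consVec u (√(1 - u ^ 2) • y))
        ∂jacobiMeasure (EuclideanSpace ℝ (Fin k)) a ∂jacobiMeasure ℝ (a + k / 2) := by
  have hF' : Measurable fun q : ℝ × EuclideanSpace ℝ (Fin k) =>
      F (consVec q.1 (√(1 - q.1 ^ 2) • q.2)) :=
    hF.comp (measurable_consVec.comp (measurable_fst.prodMk
      (Measurable.smul (f := fun q : ℝ × EuclideanSpace ℝ (Fin k) => √(1 - q.1 ^ 2))
        (by fun_prop) measurable_snd)))
  have hG : Measurable ((closedBall 0 1).indicator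
      fun x : EuclideanSpace ℝ (Fin (k + 1)) => ENNReal.ofReal (1 - ‖x‖ ^ 2) ^ a * F x) :=
    ((measurable_jacobiWeight a).mul hF).indicator measurableSet_closedBall
  rw [lintegral_jacobiMeasure a hF, ← lintegral_indicator measurableSet_closedBall,
    lintegral_eq_lintegral_consVec hG, lintegral_jacobiMeasure _ hF'.lintegral_prod_right',
    ← lintegral_indicator measurableSet_closedBall]
  refine lintegral_congr_ae ?_
  -- At `u = ±1` the scaling factor is zero and the change of variables fails; these two points are
  -- null.
  filter_upwards [Measure.ae_ne volume (1 : ℝ), Measure.ae_ne volume (-1 : ℝ)] with u hu hu'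
  have hsq : u ^ 2 ≠ 1 := by
    intro h
    rcases (sq_eq_sq_iff_eq_or_eq_neg.1 (h.trans (one_pow 2).symm)) with h | h <;> contradiction
  have hball : ∀ {n : ℕ} (x : EuclideanSpace ℝ (Fin n)), x ∈ closedBall 0 1 ↔ ‖x‖ ^ 2 ≤ 1 :=
    fun x => by rw [mem_closedBall_zero_iff, sq_le_one_iff₀ (norm_nonneg x)]
  have hGu : Measurable fun y : EuclideanSpace ℝ (Fin k) => (closedBall 0 1).indicator
      (fun x : EuclideanSpace ℝ (Fin (k + 1)) => ENNReal.ofReal (1 - ‖x‖ ^ 2) ^ a * F x)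
        (consVec u y) :=
    hG.comp (measurable_consVec.comp (measurable_const.prodMk measurable_id))
  have hFu : Measurable fun y : EuclideanSpace ℝ (Fin k) => F (consVec u (√(1 - u ^ 2) • y)) :=
    hF'.comp (measurable_const.prodMk measurable_id)
  by_cases h1 : u ^ 2 < 1
  · have hs : 0 < 1 - u ^ 2 := sub_pos.2 h1
    have hsqrt := Real.sqrt_pos.2 hs
    have hmem : u ∈ closedBall (0 : ℝ) 1 := by
      rw [mem_closedBall_zero_iff, ← sq_le_one_iff₀ (norm_nonneg u), Real.norm_eq_abs, sq_abs]
      exact h1.le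
    rw [indicator_of_mem hmem,
      lintegral_eq_ofReal_pow_mul_lintegral_smul volume hGu hsqrt,
      lintegral_jacobiMeasure a hFu,
      ← lintegral_indicator measurableSet_closedBall]
    have hnorm (y : EuclideanSpace ℝ (Fin k)) : 1 - ‖consVec u (√(1 - u ^ 2) • y)‖ ^ 2 =
        (1 - u ^ 2) * (1 - ‖y‖ ^ 2) := by
      rw [norm_consVec_sq, norm_smul, mul_pow, Real.norm_eq_abs, sq_abs, Real.sq_sqrt hs.le]
      ring
    have hint (y : EuclideanSpace ℝ (Fin k)) : (closedBall 0 1).indicator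
        (fun x : EuclideanSpace ℝ (Fin (k + 1)) => ENNReal.ofReal (1 - ‖x‖ ^ 2) ^ a * F x)
          (consVec u (√(1 - u ^ 2) • y)) = ENNReal.ofReal (1 - u ^ 2) ^ a *
        (closedBall 0 1).indicator (fun y => ENNReal.ofReal (1 - ‖y‖ ^ 2) ^ a *
          F (consVec u (√(1 - u ^ 2) • y))) y := by
      by_cases hy : ‖y‖ ^ 2 ≤ 1
      · rw [indicator_of_mem ((hball _).2 _), indicator_of_mem ((hball _).2 hy), hnorm,
          ENNReal.ofReal_mul hs.le, ENNReal.mul_rpow_of_ne_top ENNReal.ofReal_ne_top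
            ENNReal.ofReal_ne_top, mul_assoc]
        have := mul_nonneg hs.le (sub_nonneg.2 hy)
        linarith [hnorm y]
      · rw [indicator_of_notMem (mt (hball _).1 _), indicator_of_notMem (mt (hball _).1 hy),
          mul_zero]
        have := mul_pos hs (sub_pos.2 (not_le.1 hy))
        have := hnorm y
        nlinarith
    have hpow : ENNReal.ofReal (√(1 - u ^ 2) ^ k) * ENNReal.ofReal (1 - u ^ 2) ^ a =
        ENNReal.ofReal (1 - ‖u‖ ^ 2) ^ (a + k / 2) := by
      rw [Real.norm_eq_abs, sq_abs, ENNReal.ofReal_rpow_of_pos hs, ENNReal.ofReal_rpow_of_pos hs,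
        ← ENNReal.ofReal_mul (by positivity), Real.sqrt_eq_rpow, ← Real.rpow_mul_natCast hs.le,
        ← Real.rpow_add hs]
      congr 2
      ring
    have hW : Measurable fun y : EuclideanSpace ℝ (Fin k) =>
        ENNReal.ofReal (1 - ‖y‖ ^ 2) ^ a * F (consVec u (√(1 - u ^ 2) • y)) :=
      (measurable_jacobiWeight a).mul hFu
    simp only [finrank_euclideanSpace, Fintype.card_fin, hint]
    rw [lintegral_const_mul _ (hW.indicator measurableSet_closedBall), ← mul_assoc, hpow]
  · have h2 : 1 < u ^ 2 := lt_of_le_of_ne (not_lt.1 h1) hsq.symm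
    have hmem : u ∉ closedBall (0 : ℝ) 1 := by
      rw [mem_closedBall_zero_iff, ← sq_le_one_iff₀ (norm_nonneg u), Real.norm_eq_abs, sq_abs]
      exact not_le.2 h2
    rw [indicator_of_notMem hmem, lintegral_eq_zero_iff hGu]
    refine Filter.Eventually.of_forall fun y => indicator_of_notMem (mt (hball _).1 ?_) _
    rw [norm_consVec_sq]
    nlinarith [sq_nonneg ‖y‖]

/-! ### Total mass of the weighted balls -/

theorem jacobiMeasure_real_univ {b : ℝ} (hb : -1 < b) : jacobiMeasure ℝ b univ =
    ENNReal.ofReal (√Real.pi * Real.Gamma (b + 1) / Real.Gamma (b + 3 / 2)) := by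
  have hβ : 0 < ProbabilityTheory.beta (b + 1) (b + 1) :=
    ProbabilityTheory.beta_pos (by linarith) (by linarith)
  have hpdf := ProbabilityTheory.lintegral_betaPDF_eq_one (α := b + 1) (β := b + 1)
    (by linarith) (by linarith)
  have hG : Measurable ((Ioo (-1 : ℝ) 1).indicator fun u => ENNReal.ofReal (1 - u ^ 2) ^ b) :=
    Measurable.indicator (by fun_prop) measurableSet_Ioo
  -- The substitution `u = 2t - 1` gives `1 - u² = 4t(1 - t)`, a multiple of a Beta density.
  have hcongr (t : ℝ) : (Ioo (-1 : ℝ) 1).indicator (fun u => ENNReal.ofReal (1 - u ^ 2) ^ b)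
      (2 * t + -1) = ENNReal.ofReal (4 ^ b * ProbabilityTheory.beta (b + 1) (b + 1)) *
        ProbabilityTheory.betaPDF (b + 1) (b + 1) t := by
    by_cases ht : 0 < t ∧ t < 1
    · have ht' := sub_pos.2 ht.2
      have hmem : 2 * t + -1 ∈ Ioo (-1 : ℝ) 1 := ⟨by linarith [ht.1], by linarith [ht.2]⟩
      rw [indicator_of_mem hmem,
        ProbabilityTheory.betaPDF_of_pos_lt_one ht.1 ht.2, ← ENNReal.ofReal_mul (by positivity),
        show 1 - (2 * t + -1) ^ 2 = 4 * t * (1 - t) by ring,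
        ENNReal.ofReal_rpow_of_pos (mul_pos (mul_pos four_pos ht.1) ht'),
        Real.mul_rpow (mul_pos four_pos ht.1).le ht'.le, Real.mul_rpow four_pos.le ht.1.le,
        add_sub_cancel_right]
      congr 1
      field_simp
    · rw [indicator_of_notMem fun h => ht ⟨by linarith [h.1], by linarith [h.2]⟩,
        ProbabilityTheory.betaPDF_eq, if_neg ht, ENNReal.ofReal_zero, mul_zero]
  have hshift := lintegral_add_right_eq_self (μ := (volume : Measure ℝ))
    ((Ioo (-1 : ℝ) 1).indicator fun u => ENNReal.ofReal (1 - u ^ 2) ^ b) (-1)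
  rw [← setLIntegral_one, Measure.restrict_univ, lintegral_jacobiMeasure b measurable_const,
    Real.closedBall_eq_Icc, zero_sub, zero_add, ← restrict_Ioo_eq_restrict_Icc,
    ← lintegral_indicator measurableSet_Ioo]
  simp only [Real.norm_eq_abs, sq_abs, mul_one]
  rw [← hshift, lintegral_eq_ofReal_pow_mul_lintegral_smul volume
    (F := fun t => (Ioo (-1 : ℝ) 1).indicator (fun u => ENNReal.ofReal (1 - u ^ 2) ^ b) (t + -1))
    (hG.comp (measurable_id.add_const (-1))) two_pos]
  simp only [smul_eq_mul, hcongr]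
  rw [lintegral_const_mul (f := ProbabilityTheory.betaPDF (b + 1) (b + 1)) _
    (ProbabilityTheory.measurable_betaPDFReal _ _).ennreal_ofReal, hpdf, mul_one,
    ← ENNReal.ofReal_mul (by simp)]
  congr 1
  have hdup := Real.Gamma_mul_Gamma_add_half (b + 1)
  rw [show b + 1 + 1 / 2 = b + 3 / 2 by ring] at hdup
  have h1 : Real.Gamma (b + 3 / 2) ≠ 0 := (Real.Gamma_pos_of_pos (by linarith)).ne'
  have h2 : Real.Gamma (b + 1 + (b + 1)) ≠ 0 := (Real.Gamma_pos_of_pos (by linarith)).ne'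
  rw [ProbabilityTheory.beta, Module.finrank_self, pow_one]
  -- The Jacobian `2` and the factor `4^b` cancel the power of two in Legendre's duplication
  -- formula.
  have h4 : (2 : ℝ) * 4 ^ b * 2 ^ (1 - 2 * (b + 1)) = 1 := by
    rw [show (4 : ℝ) = 2 ^ (2 : ℝ) by norm_num, ← Real.rpow_mul two_pos.le,
      mul_assoc, ← Real.rpow_add two_pos, show 2 * b + (1 - 2 * (b + 1)) = -1 by ring,
      Real.rpow_neg_one, mul_inv_cancel₀ two_ne_zero]
  rw [show 2 * (b + 1) = b + 1 + (b + 1) by ring] at hdup h4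
  generalize Real.Gamma (b + 1 + (b + 1)) = G₂ at *
  generalize Real.Gamma (b + 3 / 2) = G₃ at *
  field_simp
  linear_combination (2 * 4 ^ b * Real.Gamma (b + 1)) * hdup +
    (G₂ * √Real.pi * Real.Gamma (b + 1)) * h4

/-- Each slicing contributes the one-dimensional mass at exponent `a + k/2`, and the Gamma quotients
telescope. The base case, a point of mass one, covers `m = 1`. -/
theorem jacobiMeasure_euclideanSpace_univ (k : ℕ) {a : ℝ} (ha : -1 < a) :
    jacobiMeasure (EuclideanSpace ℝ (Fin k)) a univ =
      ENNReal.ofReal (Real.pi ^ ((k : ℝ) / 2) * Real.Gamma (a + 1) /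
        Real.Gamma (a + 1 + k / 2)) := by
  induction k with
  | zero =>
    have h1 : Real.Gamma (a + 1) ≠ 0 := (Real.Gamma_pos_of_pos (by linarith)).ne'
    rw [← setLIntegral_one, Measure.restrict_univ, lintegral_jacobiMeasure a measurable_const,
      volume_euclideanSpace_eq_dirac]
    have huniv : closedBall (0 : EuclideanSpace ℝ (Fin 0)) 1 = univ :=
      eq_univ_of_forall fun x => by simp [Subsingleton.elim x 0]
    rw [huniv, Measure.restrict_univ, lintegral_dirac]
    simp [h1]
  | succ k ih =>
    have hk : (0 : ℝ) ≤ k := k.cast_nonneg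
    have h1 : Real.Gamma (a + 1 + k / 2) ≠ 0 := (Real.Gamma_pos_of_pos (by linarith)).ne'
    have h2 := Real.Gamma_pos_of_pos (show 0 < a + 1 by linarith)
    have h3 := Real.Gamma_pos_of_pos (show 0 < a + 1 + k / 2 by linarith)
    rw [← setLIntegral_one, Measure.restrict_univ,
      lintegral_jacobiMeasure_eq_lintegral_fiber a measurable_const]
    simp only [lintegral_const, one_mul]
    rw [ih, jacobiMeasure_real_univ (by linarith), ← ENNReal.ofReal_mul (by positivity),
      show a + k / 2 + 1 = a + 1 + k / 2 by ring,
      show a + k / 2 + 3 / 2 = a + 1 + (k + 1 : ℕ) / 2 by push_cast; ring]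
    congr 1
    rw [Real.sqrt_eq_rpow, show ((k + 1 : ℕ) : ℝ) / 2 = k / 2 + 1 / 2 by push_cast; ring,
      Real.rpow_add Real.pi_pos]
    generalize Real.Gamma (a + 1 + k / 2) = G at *
    field_simp

theorem jacobiMeasure_euclideanSpace_univ_ne_zero (k : ℕ) {a : ℝ} (ha : -1 < a) :
    jacobiMeasure (EuclideanSpace ℝ (Fin k)) a univ ≠ 0 := by
  have h1 := Real.Gamma_pos_of_pos (show 0 < a + 1 by linarith)
  have h2 := Real.Gamma_pos_of_pos (show 0 < a + 1 + k / 2 by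
    have : (0 : ℝ) ≤ k := k.cast_nonneg
    linarith)
  rw [jacobiMeasure_euclideanSpace_univ k ha, ENNReal.ofReal_ne_zero_iff]
  positivity

theorem isFiniteMeasure_jacobiMeasure (k : ℕ) {a : ℝ} (ha : -1 < a) :
    IsFiniteMeasure (jacobiMeasure (EuclideanSpace ℝ (Fin k)) a) :=
  ⟨by rw [jacobiMeasure_euclideanSpace_univ k ha]; exact ENNReal.ofReal_lt_top⟩

/-! ### Fiber averages of polynomials -/

theorem Continuous.integrable_jacobiMeasure {k : ℕ} {a : ℝ} (ha : -1 < a)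
    {g : EuclideanSpace ℝ (Fin k) → ℂ} (hg : Continuous g) :
    Integrable g (jacobiMeasure (EuclideanSpace ℝ (Fin k)) a) := by
  have := isFiniteMeasure_jacobiMeasure k ha
  obtain ⟨C, hC⟩ := (isCompact_closedBall (0 : EuclideanSpace ℝ (Fin k)) 1)
    |>.exists_bound_of_continuousOn hg.continuousOn
  refine Integrable.of_bound hg.aestronglyMeasurable C ?_
  exact (withDensity_absolutelyContinuous _ _).ae_le
    ((ae_restrict_mem measurableSet_closedBall).mono hC)

instance {k : ℕ} (a : ℝ) : (jacobiMeasure (EuclideanSpace ℝ (Fin k)) a).IsNegInvariant where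
  neg_eq_self := by
    refine Measure.ext_of_lintegral _ fun f hf => ?_
    have hneg : Measurable fun x => f (-x) := hf.comp measurable_neg
    rw [Measure.neg, lintegral_map hf measurable_neg, lintegral_jacobiMeasure a hf,
      lintegral_jacobiMeasure a hneg,
      ← lintegral_indicator measurableSet_closedBall,
      ← lintegral_indicator measurableSet_closedBall, ← lintegral_neg_eq_self]
    refine lintegral_congr fun x => ?_
    simp only [indicator, mem_closedBall_zero_iff, norm_neg, neg_neg]

/-- The integrand is odd under `y ↦ -y`, which preserves the measure. -/
theorem integral_monomial_jacobiMeasure_eq_zero {k : ℕ} (a : ℝ) {d : Fin k → ℕ}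
    (hd : Odd (∑ i, d i)) :
    ∫ y, ∏ i, (y i : ℂ) ^ d i ∂jacobiMeasure (EuclideanSpace ℝ (Fin k)) a = 0 := by
  have h := integral_neg_eq_self (fun y : EuclideanSpace ℝ (Fin k) => ∏ i, (y i : ℂ) ^ d i)
    (jacobiMeasure (EuclideanSpace ℝ (Fin k)) a)
  have hneg (y : EuclideanSpace ℝ (Fin k)) :
      ∏ i, (((-y) i : ℝ) : ℂ) ^ d i = -∏ i, (y i : ℂ) ^ d i := by
    simp only [PiLp.neg_apply, Complex.ofReal_neg]
    rw [Finset.prod_congr rfl fun i _ => neg_pow (y i : ℂ) (d i), Finset.prod_mul_distrib,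
      Finset.prod_pow_eq_pow_sum, hd.neg_one_pow, neg_one_mul]
  simp only [hneg, integral_neg] at h
  exact self_eq_neg.1 h.symm

theorem exists_polynomial_eval_eq_integral_fiber {k n : ℕ} {a : ℝ} (ha : -1 < a)
    (P : MvPolynomial (Fin (k + 1)) ℂ) (hP : P.totalDegree ≤ n) :
    ∃ Q : Polynomial ℂ, Q.natDegree ≤ n ∧ ∀ u : ℝ, u ^ 2 ≤ 1 → Q.eval (u : ℂ) =
      ∫ y, MvPolynomial.eval (fun i => (consVec u (√(1 - u ^ 2) • y) i : ℂ)) P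
        ∂jacobiMeasure (EuclideanSpace ℝ (Fin k)) a := by
  let M (d : Fin (k + 1) →₀ ℕ) : ℂ :=
    ∫ y, ∏ i, (y i : ℂ) ^ d (Fin.succ i) ∂jacobiMeasure (EuclideanSpace ℝ (Fin k)) a
  let r (d : Fin (k + 1) →₀ ℕ) : ℕ := ∑ i : Fin k, d i.succ
  -- A monomial contributes `u^(d 0) √(1 - u²)^(r d)` times its moment `M d`. For even `r d` the
  -- root disappears; for odd `r d` the moment is zero, so the rounding in `r d / 2` is harmless.
  refine ⟨∑ d ∈ P.support, Polynomial.C (P.coeff d * M d) *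
    (Polynomial.X ^ d 0 * (1 - Polynomial.X ^ 2) ^ (r d / 2)), ?_, fun u hu => ?_⟩
  · refine Polynomial.natDegree_sum_le_of_forall_le _ _ fun d hd => ?_
    have hdeg : d 0 + r d ≤ n := by
      have := (MvPolynomial.le_totalDegree hd).trans hP
      rwa [Finsupp.sum_fintype _ _ fun _ => rfl, Fin.sum_univ_succ] at this
    refine (Polynomial.natDegree_C_mul_le _ _).trans (Polynomial.natDegree_mul_le.trans ?_)
    have h1 : (1 - Polynomial.X ^ 2 : Polynomial ℂ).natDegree ≤ 2 := by compute_degree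
    have h2 := Polynomial.natDegree_pow_le_of_le (r d / 2) h1
    rw [Polynomial.natDegree_X_pow]
    omega
  · have hs : (√(1 - u ^ 2) : ℂ) ^ 2 = 1 - (u : ℂ) ^ 2 := by
      rw [← Complex.ofReal_pow, Real.sq_sqrt (sub_nonneg.2 hu)]
      push_cast
      rfl
    have hterm (d : Fin (k + 1) →₀ ℕ) (y : EuclideanSpace ℝ (Fin k)) :
        P.coeff d * ∏ i, (consVec u (√(1 - u ^ 2) • y) i : ℂ) ^ d i =
          P.coeff d * ((u : ℂ) ^ d 0 * (√(1 - u ^ 2) : ℂ) ^ r d) *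
            ∏ i, (y i : ℂ) ^ d (Fin.succ i) := by
      rw [Fin.prod_univ_succ]
      simp only [consVec_zero_apply, consVec_succ_apply, PiLp.smul_apply, smul_eq_mul,
        Complex.ofReal_mul, mul_pow, Finset.prod_mul_distrib, Finset.prod_pow_eq_pow_sum, r]
      ring
    simp only [MvPolynomial.eval_eq', hterm]
    rw [integral_finsetSum _ fun d _ => Continuous.integrable_jacobiMeasure ha (by fun_prop),
      Polynomial.eval_finsetSum]
    refine Finset.sum_congr rfl fun d _ => ?_
    rw [integral_const_mul]
    simp only [Polynomial.eval_mul, Polynomial.eval_C, Polynomial.eval_pow, Polynomial.eval_X,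
      Polynomial.eval_sub, Polynomial.eval_one]
    rcases Nat.even_or_odd (r d) with hr | hr
    · rw [← hs, ← pow_mul, Nat.two_mul_div_two_of_even hr]
      ring
    · have hM : M d = 0 := integral_monomial_jacobiMeasure_eq_zero a hr
      rw [hM, show ∫ y, ∏ i, (y i : ℂ) ^ d (Fin.succ i)
        ∂jacobiMeasure (EuclideanSpace ℝ (Fin k)) a = 0 from hM]
      simp

/-! ### Norms, lifting and Hölder's inequality -/

theorem weightedNorm_closedBall_eq {E : Type*} [NormedAddCommGroup E] [MeasureSpace E]
    [BorelSpace E] (p a : ℝ) {F : E → ℂ} (hF : Measurable F) :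
    weightedNorm p (fun x => ENNReal.ofReal (1 - ‖x‖ ^ 2) ^ a) (closedBall 0 1) F =
      (∫⁻ x, ‖F x‖ₑ ^ p ∂jacobiMeasure E a) ^ (1 / p) := by
  rw [weightedNorm, lintegral_jacobiMeasure a (by fun_prop)]
  simp only [mul_comm]

theorem weightedNorm_Icc_eq (p a : ℝ) {F : ℝ → ℂ} (hF : Measurable F) :
    weightedNorm p (fun u => ENNReal.ofReal (1 - u ^ 2) ^ a) (Icc (-1) 1) F =
      (∫⁻ u, ‖F u‖ₑ ^ p ∂jacobiMeasure ℝ a) ^ (1 / p) := by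
  rw [← weightedNorm_closedBall_eq p a hF, Real.closedBall_eq_Icc, zero_sub, zero_add]
  simp only [Real.norm_eq_abs, sq_abs]

theorem continuous_of_mem_polyFun {n m : ℕ} {f : EuclideanSpace ℝ (Fin m) → ℂ}
    (hf : f ∈ polyFun n m) : Continuous f := by
  obtain ⟨P, -, hP⟩ := hf
  rw [funext hP]
  exact (MvPolynomial.continuous_eval P).comp (by fun_prop)

theorem continuous_of_mem_polyFunOne {n : ℕ} {f : ℝ → ℂ} (hf : f ∈ polyFunOne n) :
    Continuous f := by
  obtain ⟨P, -, hP⟩ := hf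
  rw [funext hP]
  exact P.continuous.comp Complex.continuous_ofReal

theorem comp_apply_zero_mem_polyFun {n k : ℕ} {q : ℝ → ℂ} (hq : q ∈ polyFunOne n) :
    (fun x : EuclideanSpace ℝ (Fin (k + 1)) => q (x 0)) ∈ polyFun n (k + 1) := by
  obtain ⟨Q, hQ, h⟩ := hq
  refine ⟨Polynomial.aeval (MvPolynomial.X 0) Q, ?_, fun x => ?_⟩
  · rw [Polynomial.aeval_eq_sum_range]
    refine MvPolynomial.totalDegree_finsetSum_le fun i hi => ?_
    refine (MvPolynomial.totalDegree_smul_le _ _).trans ?_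
    rw [MvPolynomial.totalDegree_X_pow]
    exact (Nat.lt_succ_iff.1 (Finset.mem_range.1 hi)).trans hQ
  · beta_reduce
    rw [h, Polynomial.aeval_def, Polynomial.hom_eval₂, MvPolynomial.eval_X]
    simp [Polynomial.eval, MvPolynomial.algebraMap_eq, Polynomial.eval₂_eq_sum_range]

theorem lintegral_comp_apply_zero_jacobiMeasure {k : ℕ} (a : ℝ) {F : ℝ → ℝ≥0∞}
    (hF : Measurable F) :
    ∫⁻ x, F (x 0) ∂jacobiMeasure (EuclideanSpace ℝ (Fin (k + 1))) a =
      jacobiMeasure (EuclideanSpace ℝ (Fin k)) a univ *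
        ∫⁻ u, F u ∂jacobiMeasure ℝ (a + k / 2) := by
  rw [lintegral_jacobiMeasure_eq_lintegral_fiber a (by fun_prop)]
  simp only [consVec_zero_apply, lintegral_const]
  rw [lintegral_mul_const _ hF, mul_comm]

/-- Hölder against the constant `1`; the mass is kept because the fiber measure is not normalised.
-/
theorem enorm_integral_rpow_le {α : Type*} [MeasurableSpace α] {μ : Measure α} {p : ℝ}
    (hp : 1 ≤ p) {f : α → ℂ} (hf : AEStronglyMeasurable f μ) :
    ‖∫ x, f x ∂μ‖ₑ ^ p ≤ μ univ ^ (p - 1) * ∫⁻ x, ‖f x‖ₑ ^ p ∂μ := by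
  have hp0 : 0 < p := by linarith
  have h := eLpNorm'_le_eLpNorm'_mul_rpow_measure_univ one_pos hp hf
  simp only [eLpNorm', ENNReal.rpow_one, div_one] at h
  calc ‖∫ x, f x ∂μ‖ₑ ^ p
      ≤ ((∫⁻ x, ‖f x‖ₑ ^ p ∂μ) ^ (1 / p) * μ univ ^ (1 - 1 / p)) ^ p :=
        ENNReal.rpow_le_rpow ((enorm_integral_le_lintegral_enorm f).trans h) hp0.le
    _ = _ := by
        rw [ENNReal.mul_rpow_of_nonneg _ _ hp0.le, ← ENNReal.rpow_mul, ← ENNReal.rpow_mul,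
          one_div_mul_cancel hp0.ne', ENNReal.rpow_one, mul_comm,
          show (1 - 1 / p) * p = p - 1 by field_simp]

theorem ofReal_reductionConstant (k : ℕ) {p lam : ℝ} (hlam : 0 ≤ lam) :
    ENNReal.ofReal (reductionConstant (k + 1) p lam) =
      (jacobiMeasure (EuclideanSpace ℝ (Fin k)) (lam - 1 / 2) univ)⁻¹ ^ (1 / p) := by
  have h1 := Real.Gamma_pos_of_pos (show 0 < lam + 1 / 2 by linarith)
  have h2 := Real.Gamma_pos_of_pos (show 0 < lam + 1 / 2 + k / 2 by positivity)
  rw [jacobiMeasure_euclideanSpace_univ k (by linarith), reductionConstant,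
    show lam - 1 / 2 + 1 = lam + 1 / 2 by ring,
    ← ENNReal.ofReal_inv_of_pos (by positivity), inv_div,
    ENNReal.ofReal_rpow_of_pos (by positivity)]
  push_cast
  rw [add_sub_cancel_right, show lam + 1 / 2 + (k : ℝ) / 2 = lam + (k + 1) / 2 by ring]

theorem consVec_one_zero (k : ℕ) :
    consVec 1 (0 : EuclideanSpace ℝ (Fin k)) = EuclideanSpace.single 0 1 := by
  ext i
  refine Fin.cases ?_ (fun j => ?_) i <;> simp

/-! ### The two inequalities -/

theorem propositionP4p3 (m : ℕ) (hm : 1 ≤ m) (n : ℕ) (p : ℝ) (hp : 1 ≤ p)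
    (lam : ℝ) (hlam : 0 ≤ lam) :
    pointConstant (EuclideanSpace.single (⟨0, hm⟩ : Fin m) (1 : ℝ)) (polyFun n m) p
        (fun x => ENNReal.ofReal (1 - ‖x‖ ^ 2) ^ (lam - 1 / 2)) (Metric.closedBall 0 1) =
      ENNReal.ofReal (reductionConstant m p lam) *
        pointConstant (1 : ℝ) (polyFunOne n) p
          (fun u => ENNReal.ofReal (1 - u ^ 2) ^ ((m : ℝ) / 2 + lam - 1)) (Set.Icc (-1) 1) := by
  obtain ⟨k, rfl⟩ : ∃ k, m = k + 1 := ⟨m - 1, by omega⟩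
  have hp0 : 0 < p := by linarith
  have ha : -1 < lam - 1 / 2 := by linarith
  have hfin := isFiniteMeasure_jacobiMeasure k ha
  have hK0 := jacobiMeasure_euclideanSpace_univ_ne_zero k ha
  have hKtop : jacobiMeasure (EuclideanSpace ℝ (Fin k)) (lam - 1 / 2) univ ≠ ∞ :=
    measure_ne_top _ _
  rw [ofReal_reductionConstant k hlam,
    show ((k + 1 : ℕ) : ℝ) / 2 + lam - 1 = lam - 1 / 2 + k / 2 by push_cast; ring]
  set a := lam - 1 / 2
  set K := jacobiMeasure (EuclideanSpace ℝ (Fin k)) a univ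
  rw [show (⟨0, hm⟩ : Fin (k + 1)) = 0 from rfl, pointConstant, pointConstant]
  refine le_antisymm (iSup₂_le fun h hh => ?_) ?_
  · replace hh := hh.1
    -- If `h` vanishes at the evaluation point its quotient is zero; otherwise its fiber average is
    -- nonzero at `1`, hence admissible.
    by_cases hx : h (EuclideanSpace.single 0 1) = 0
    · simp [hx]
    have hcont := continuous_of_mem_polyFun hh
    obtain ⟨P, hP, hhP⟩ := hh
    obtain ⟨Q, hQ, hQu⟩ := exists_polynomial_eval_eq_integral_fiber ha P hP
    simp only [← hhP] at hQu
    let q : ℝ → ℂ := fun u => Q.eval (u : ℂ)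
    have hq : q ∈ polyFunOne n := ⟨Q, hQ, fun _ => rfl⟩
    have hq1 : ‖q 1‖ₑ = K * ‖h (EuclideanSpace.single 0 1)‖ₑ := by
      have hint := hQu 1 (by norm_num)
      simp only [one_pow, sub_self, Real.sqrt_zero, zero_smul, consVec_one_zero, integral_const]
        at hint
      simp only [q, hint, enorm_smul]
      rw [measureReal_def, Real.enorm_of_nonneg ENNReal.toReal_nonneg, ENNReal.ofReal_toReal hKtop]
    have hq0 : q ≠ 0 := by
      intro h0
      rw [h0] at hq1
      simp only [Pi.zero_apply, enorm_zero, zero_eq_mul, enorm_eq_zero] at hq1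
      tauto
    have hnorm : weightedNorm p (fun u => ENNReal.ofReal (1 - u ^ 2) ^ (a + k / 2)) (Icc (-1) 1) q ≤
        K ^ (1 - 1 / p) *
          weightedNorm p (fun x => ENNReal.ofReal (1 - ‖x‖ ^ 2) ^ a) (closedBall 0 1) h := by
      rw [weightedNorm_Icc_eq p _ (continuous_of_mem_polyFunOne hq).measurable,
        weightedNorm_closedBall_eq p a hcont.measurable,
        lintegral_jacobiMeasure_eq_lintegral_fiber a (by fun_prop),
        show 1 - 1 / p = (p - 1) * (1 / p) by field_simp, ENNReal.rpow_mul,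
        ← ENNReal.mul_rpow_of_nonneg _ _ (by positivity),
        ← lintegral_const_mul' _ _ (ENNReal.rpow_ne_top_of_nonneg (by linarith) hKtop)]
      refine ENNReal.rpow_le_rpow (lintegral_mono_ae ?_) (by positivity)
      filter_upwards [(withDensity_absolutelyContinuous _ _).ae_le
        (ae_restrict_mem measurableSet_closedBall)] with u hu
      rw [mem_closedBall_zero_iff, ← sq_le_one_iff₀ (norm_nonneg u), Real.norm_eq_abs, sq_abs] at hu
      simp only [q, hQu u hu]
      exact enorm_integral_rpow_le hp (hcont.measurable.comp (measurable_consVec.comp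
        (measurable_const.prodMk (measurable_const_smul _)))).aestronglyMeasurable
    refine le_trans ?_ (mul_le_mul_right (le_iSup₂_of_le q ⟨hq, hq0⟩ le_rfl) _)
    have hc0 : K ^ (1 - 1 / p) ≠ 0 := by simp [ENNReal.rpow_eq_zero_iff, hK0, hKtop]
    have hctop : K ^ (1 - 1 / p) ≠ ∞ := by simp [ENNReal.rpow_eq_top_iff, hK0, hKtop]
    have hinv := ENNReal.inv_le_inv.2 hnorm
    rw [ENNReal.mul_inv (.inl hc0) (.inl hctop), ← ENNReal.rpow_neg] at hinv
    -- The constant, the value at `1` and the norm bound contribute exponents `-1/p`, `1` and `-(1 -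
    -- 1/p)`, with sum zero.
    have hone : K⁻¹ ^ (1 / p) * K * K ^ (-(1 - 1 / p)) = 1 := by
      rw [ENNReal.inv_rpow, ← ENNReal.rpow_neg]
      nth_rw 2 [← ENNReal.rpow_one K]
      rw [← ENNReal.rpow_add _ _ hK0 hKtop, ← ENNReal.rpow_add _ _ hK0 hKtop]
      ring_nf
      exact ENNReal.rpow_zero
    rw [hq1, div_eq_mul_inv ‖h _‖ₑ, div_eq_mul_inv (K * _)]
    calc _ = K⁻¹ ^ (1 / p) * (K * ‖h (EuclideanSpace.single 0 1)‖ₑ * (K ^ (-(1 - 1 / p)) *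
          (weightedNorm p (fun x => ENNReal.ofReal (1 - ‖x‖ ^ 2) ^ a) (closedBall 0 1) h)⁻¹)) := by
            rw [← one_mul (‖h (EuclideanSpace.single 0 1)‖ₑ * _), ← hone]
            ring
      _ ≤ _ := by gcongr
  · rw [ENNReal.mul_iSup]
    refine iSup_le fun q => ?_
    rw [ENNReal.mul_iSup]
    refine iSup_le fun ⟨hq, hq0⟩ => ?_
    refine le_iSup₂_of_le (fun x : EuclideanSpace ℝ (Fin (k + 1)) => q (x 0))
      ⟨comp_apply_zero_mem_polyFun hq, fun h0 => hq0 (funext fun u => ?_)⟩ (le_of_eq ?_)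
    · simpa using congrFun h0 (EuclideanSpace.single 0 u)
    · have hmeas := (continuous_of_mem_polyFunOne hq).measurable
      have hc0 : K ^ (1 / p) ≠ 0 := by simp [ENNReal.rpow_eq_zero_iff, hK0, hKtop]
      have hctop : K ^ (1 / p) ≠ ∞ := ENNReal.rpow_ne_top_of_nonneg (by positivity) hKtop
      have hint := lintegral_comp_apply_zero_jacobiMeasure (k := k) a
        (F := fun u => ‖q u‖ₑ ^ p) (by fun_prop)
      change _ = K * _ at hint
      rw [weightedNorm_Icc_eq p _ hmeas, weightedNorm_closedBall_eq p a (by fun_prop), hint,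
        ENNReal.mul_rpow_of_nonneg _ _ (by positivity), div_eq_mul_inv ‖q 1‖ₑ,
        div_eq_mul_inv ‖q _‖ₑ,        ENNReal.mul_inv (.inl hc0) (.inl hctop), ENNReal.inv_rpow]
      simp only [PiLp.single_apply, if_true]
      exact mul_left_comm _ _ _
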